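/- **Setting.** Let $n,d\ge 1$ and let $f_1,\dots,f_n:\mathbb R^d\to\mathbb R$ be twice continuously differentiable. Let $\mu>0$, $L$ and $\tilde L$ be real constants such that, for all $i\in\{1,\dots,n\}$ and all $x,y\in\mathbb R^d$, $$\tfrac{\mu}{2}\|y-x\|^2\le f_i(y)-f_i(x)-\langle\nabla f_i(x),y-x\rangle\le\tfrac{L}{2}\|y-x\|^2,\qquad \|\nabla^2f_i(y)-\nabla^2f_i(x)\|\le\tilde L\|y-x\|$$ (Euclidean norm for vectors, spectral norm for matrices). Let $x^\star$ be the minimizer of $\frac1n\sum_{i=1}^nf_i$ and put $M=\tilde L\mu^{-3/2}$. For matrices $B,K\in\mathbb R^{d\times d}$ and $u\in\mathbb R^d$ let $$\mathrm{BFGS}(B,K,u)=B-\frac{Buu^{\mathsf T}B}{\langle u,Bu\rangle}+\frac{Kuu^{\mathsf T}K}{\langle u,Ku\rangle},$$ with $\mathrm{BFGS}(B,K,0)=B$. A greedy vector $\bar u(B,K)$ is a standard basis vector that maximizes $\langle e,Be\rangle/\langle e,Ke\rangle$ over the standard basis vectors $e$ (ties are broken arbitrarily). Let $\sigma(B,K)=\mathrm{Tr}(K^{-1}(B-K))$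 for symmetric $B$ and symmetric invertible $K$. **SIQN (Sharpened Incremental Quasi-Newton).** Start from $x^0\in\mathbb R^d$, $z_i^0=x^0$ and matrices $B_i^0$ with $B_i^0\succeq\nabla^2f_i(x^0)$ for all $i$. For $t=1,2,\dots$, with $i_t=1+(t-1)\bmod n$: $$x^t=\Big(\sum_{i=1}^nB_i^{t-1}\Big)^{-1}\sum_{i=1}^n\big(B_i^{t-1}z_i^{t-1}-\nabla f_i(z_i^{t-1})\big);$$ $z_{i_t}^t=x^t$; $z_j^t=z_j^{t-1}$ and $B_j^t=B_j^{t-1}$ for $j\ne i_t$; and, with $s=z_{i_t}^t-z_{i_t}^{t-1}$, $\beta_t=\frac M2\sqrt{\langle s,\nabla^2f_{i_t}(z_{i_t}^{t-1})s\rangle}$ and $K^t=\int_0^1\nabla^2f_{i_t}(z_{i_t}^{t-1}+\tau s)\,d\tau$, $$Q^t=\mathrm{BFGS}\big((1+\beta_t)^2B_{i_t}^{t-1},(1+\beta_t)K^t,s\big),\qquad B_{i_t}^t=\mathrm{BFGS}\big(Q^t,\nabla^2f_{i_t}(z_{i_t}^t),\bar u(Q^t,\nabla^2f_{i_t}(z_{i_t}^t))\big).$$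 **Lemma (superlinear rate of SIQN).** For every $\rho$ with $0<\rho<1-\frac{\mu}{dL}$ there exist constants $\epsilon>0$ and $\sigma_0>0$ such that for every run of SIQN with $\|x^0-x^\star\|\le\epsilon$ and $\sigma(B_i^0,\nabla^2f_i(x^0))\le\sigma_0$ for all $i$, there is a sequence $(\zeta^k)_{k\ge0}$ of real numbers ($k$ is an index) with $$\|x^t-x^\star\|\le\zeta^{\lfloor (t-1)/n\rfloor}\quad\text{for all }t\ge1,\qquad \zeta^k\le\epsilon\Big(1-\frac{\mu}{dL}\Big)^{\frac{(k+1)(k+2)}{2}}\quad\text{for all }k\ge0.$$ -/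

import Mathlib

open scoped Matrix

namespace SIQN

/-- The space `ℝᵈ` with the Euclidean norm. -/
abbrev Vec (d : ℕ) := EuclideanSpace ℝ (Fin d)

/-- Real `d × d` matrices. -/
abbrev Mat (d : ℕ) := Matrix (Fin d) (Fin d) ℝ

/-- The Hessian matrix `∇²f(x)`: the Jacobian matrix of the gradient of `f` at `x`. -/
noncomputable def hessian {d : ℕ} (f : Vec d → ℝ) (x : Vec d) : Mat d :=
  Matrix.of fun i j => (fderiv ℝ (gradient f) x (EuclideanSpace.single j 1)) i

/-- The spectral norm of a matrix: its operator norm for the Euclidean norm. -/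
noncomputable def specNorm {d : ℕ} (A : Mat d) : ℝ :=
  ‖Matrix.toEuclideanCLM (n := Fin d) (𝕜 := ℝ) A‖

/-- `f` is `μ`-strongly convex and `L`-smooth. -/
def StronglyConvexSmooth {d : ℕ} (μ L : ℝ) (f : Vec d → ℝ) : Prop :=
  ∀ x y : Vec d,
    μ / 2 * ‖y - x‖ ^ 2 ≤ f y - f x - inner ℝ (gradient f x) (y - x) ∧
      f y - f x - inner ℝ (gradient f x) (y - x) ≤ L / 2 * ‖y - x‖ ^ 2

/-- The Hessian of `f` is `Lt`-Lipschitz continuous for the spectral norm. -/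
def HessianLipschitz {d : ℕ} (Lt : ℝ) (f : Vec d → ℝ) : Prop :=
  ∀ x y : Vec d, specNorm (hessian f y - hessian f x) ≤ Lt * ‖y - x‖

/-- The quadratic form `⟨u, A u⟩`. -/
def quadForm {d : ℕ} (A : Mat d) (u : Fin d → ℝ) : ℝ := u ⬝ᵥ (A *ᵥ u)

/-- The local norm `‖y‖_x = √⟨y, ∇²f(x) y⟩`. -/
noncomputable def localNorm {d : ℕ} (f : Vec d → ℝ) (x y : Vec d) : ℝ :=
  √(quadForm (hessian f x) y.ofLp)

/-- The generalized BFGS update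
`B - B u uᵀ B / ⟨u, B u⟩ + K u uᵀ K / ⟨u, K u⟩`.
For `u = 0` it is `B`, by the convention `0 / 0 = 0`. -/
noncomputable def bfgs {d : ℕ} (B K : Mat d) (u : Fin d → ℝ) : Mat d :=
  B - (quadForm B u)⁻¹ • Matrix.vecMulVec (B *ᵥ u) (u ᵥ* B)
    + (quadForm K u)⁻¹ • Matrix.vecMulVec (K *ᵥ u) (u ᵥ* K)

/-- `u` is a greedy vector for `(B, K)`: a standard basis vector that maximizes
`⟨e, B e⟩ / ⟨e, K e⟩` over the standard basis vectors `e`. -/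
def IsGreedyVector {d : ℕ} (B K : Mat d) (u : Fin d → ℝ) : Prop :=
  ∃ k : Fin d, u = Pi.single k 1 ∧
    ∀ j : Fin d, quadForm B (Pi.single j 1) / quadForm K (Pi.single j 1) ≤
      quadForm B u / quadForm K u

/-- The approximation error `σ(B, K) = ⟨K⁻¹, B - K⟩`, where `⟨X, Y⟩ = Tr(Xᵀ Y)`. -/
noncomputable def sigmaErr {d : ℕ} (B K : Mat d) : ℝ :=
  ((K⁻¹)ᵀ * (B - K)).trace

/-- The averaged Hessian `∫₀¹ ∇²f(a + τ (b - a)) dτ`, taken entry by entry. -/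
noncomputable def avgHessian {d : ℕ} (f : Vec d → ℝ) (a b : Vec d) : Mat d :=
  Matrix.of fun i j => ∫ τ in (0 : ℝ)..1, hessian f (a + τ • (b - a)) i j

/-- `B'` is obtained from `B` by a sharpened update for `f`, as the stored point moves from
`a` to `b`: a classical BFGS update after the correction by
`β = (M / 2) ‖b - a‖_a`, followed by a greedy BFGS update. -/
def SharpenedUpdate {d : ℕ} (M : ℝ) (f : Vec d → ℝ) (a b : Vec d) (B B' : Mat d) : Prop :=
  ∃ (β : ℝ) (Q : Mat d) (u : Fin d → ℝ),
    β = M / 2 * localNorm f a (b - a) ∧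
    Q = bfgs ((1 + β) ^ 2 • B) ((1 + β) • avgHessian f a b) (b - a).ofLp ∧
    IsGreedyVector Q (hessian f b) u ∧
    B' = bfgs Q (hessian f b) u

/-- `x t`, `z t i`, `B t i` are the iterates, stored points and Hessian approximations of a run
of SIQN on `f 0, …, f (n - 1)` with correction parameter `M`. The indices are counted from `0`,
so that iteration `t + 1` updates the index `t % n`. -/
structure IsRun {n d : ℕ} (M : ℝ) (f : Fin n → Vec d → ℝ)
    (x : ℕ → Vec d) (z : ℕ → Fin n → Vec d) (B : ℕ → Fin n → Mat d) : Prop where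
  z_init : ∀ i, z 0 i = x 0
  B_init : ∀ i, (B 0 i - hessian (f i) (z 0 i)).PosSemidef
  x_step : ∀ t, x (t + 1) =
    WithLp.toLp 2 ((∑ i, B t i)⁻¹ *ᵥ
      (∑ i, (B t i *ᵥ (z t i).ofLp - (gradient (f i) (z t i)).ofLp)))
  z_active : ∀ t (i : Fin n), (i : ℕ) = t % n → z (t + 1) i = x (t + 1)
  B_active : ∀ t (i : Fin n), (i : ℕ) = t % n →
    SharpenedUpdate M (f i) (z t i) (z (t + 1) i) (B t i) (B (t + 1) i)
  z_other : ∀ t (i : Fin n), (i : ℕ) ≠ t % n → z (t + 1) i = z t i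
  B_other : ∀ t (i : Fin n), (i : ℕ) ≠ t % n → B (t + 1) i = B t i

end SIQN

/-! ### Quadratic forms, the Loewner order and traces. -/

namespace SIQN

open Matrix

variable {d : ℕ}

/-! Put r = 1 - μ/(dL) and index everything by the number k of updates a component has received. The
claim carried along a run is that its stored point lies within ε r^(k(k+1)/2) of the minimizer, that
its matrix dominates the Hessian there, and that its error σ is at most a small constant times r^k.

Two estimates feed each other. The gradients sum to zero at the minimizer, so the new iterate's
error is a Newton-type residual, and `norm_step_sub_le` bounds it by (Lσ + Lt e)/μ · e. With σ and e
both a small constant times r^k, the factor is at most r^(k+1): the contraction factor itself decays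
geometrically, and the exponents add up to triangular numbers.

Conversely, a greedy BFGS update multiplies σ by r (`sigmaErr_bfgs_greedy_le`). Before it, scaling
by powers of 1 + β keeps the matrix above the moving Hessian, at the price of a factor (1 + β)^4 on
σ + d (`corrected_bfgs`, `SharpenedUpdate.bounds`). Since β is at most a multiple of the point
error, this perturbation is summable against r^k and `sigmaBound` absorbs it (`le_sigmaBound_succ`).
`IsRun.bounds` runs the joint induction. -/

lemma dotProduct_mulVec_comm_of_isSymm {A : Mat d} (hA : A.IsSymm) (u v : Fin d → ℝ) :
    u ⬝ᵥ (A *ᵥ v) = v ⬝ᵥ (A *ᵥ u) := by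
  rw [dotProduct_mulVec, ← mulVec_transpose, hA.eq, dotProduct_comm]

lemma vecMul_eq_mulVec_of_isSymm {A : Mat d} (hA : A.IsSymm) (u : Fin d → ℝ) :
    u ᵥ* A = A *ᵥ u := by
  rw [← mulVec_transpose, hA.eq]

lemma quadForm_add (A B : Mat d) (v : Fin d → ℝ) :
    quadForm (A + B) v = quadForm A v + quadForm B v := by
  simp [quadForm, add_mulVec, dotProduct_add]

lemma quadForm_sub (A B : Mat d) (v : Fin d → ℝ) :
    quadForm (A - B) v = quadForm A v - quadForm B v := by
  simp [quadForm, sub_mulVec, dotProduct_sub]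

lemma quadForm_smul (c : ℝ) (A : Mat d) (v : Fin d → ℝ) :
    quadForm (c • A) v = c * quadForm A v := by
  simp [quadForm, smul_mulVec, dotProduct_smul]

lemma quadForm_sum {ι : Type*} (s : Finset ι) (A : ι → Mat d) (v : Fin d → ℝ) :
    quadForm (∑ i ∈ s, A i) v = ∑ i ∈ s, quadForm (A i) v := by
  simp [quadForm, sum_mulVec, dotProduct_sum]

lemma quadForm_zero_right (A : Mat d) : quadForm A 0 = 0 := by
  simp [quadForm]

lemma quadForm_one (v : Fin d → ℝ) : quadForm (1 : Mat d) v = v ⬝ᵥ v := by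
  simp [quadForm]

lemma quadForm_single (A : Mat d) (j : Fin d) : quadForm A (Pi.single j 1) = A j j := by
  simp [quadForm]

lemma quadForm_sub_smul {A : Mat d} (hA : A.IsSymm) (x u : Fin d → ℝ) (t : ℝ) :
    quadForm A (x - t • u) = quadForm A x - 2 * t * (u ⬝ᵥ (A *ᵥ x)) + t ^ 2 * quadForm A u := by
  simp only [quadForm, mulVec_sub, mulVec_smul, sub_dotProduct, dotProduct_sub, smul_dotProduct,
    dotProduct_smul, smul_eq_mul, dotProduct_mulVec_comm_of_isSymm hA x u]
  ring

/-- The Cauchy–Schwarz inequality for a positive semidefinite form. -/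
lemma sq_dotProduct_mulVec_le {A : Mat d} (hA : A.IsSymm) (h0 : ∀ v, 0 ≤ quadForm A v)
    (u v : Fin d → ℝ) : (u ⬝ᵥ (A *ᵥ v)) ^ 2 ≤ quadForm A u * quadForm A v := by
  have h : ∀ t : ℝ, 0 ≤ quadForm A u * (t * t) + (-2 * (u ⬝ᵥ (A *ᵥ v))) * t + quadForm A v := by
    intro t
    have := h0 (v - t • u)
    rw [quadForm_sub_smul hA] at this
    linarith
  have := discrim_le_zero h
  rw [discrim] at this
  linarith

lemma posDef_of_lt {A : Mat d} (hA : A.IsSymm) (h : ∀ v, v ≠ 0 → 0 < quadForm A v) : A.PosDef :=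
  PosDef.of_dotProduct_mulVec_pos (by rwa [IsHermitian, conjTranspose_eq_transpose_of_trivial]) (by simpa [quadForm] using h)

lemma posSemidef_of_nonneg {A : Mat d} (hA : A.IsSymm) (h : ∀ v, 0 ≤ quadForm A v) :
    A.PosSemidef :=
  PosSemidef.of_dotProduct_mulVec_nonneg
    (by rwa [IsHermitian, conjTranspose_eq_transpose_of_trivial])
    (by simpa [quadForm] using h)

lemma _root_.Matrix.PosSemidef.isSymm {A : Mat d} (hA : A.PosSemidef) : A.IsSymm := by
  have := hA.isHermitian
  rwa [IsHermitian, conjTranspose_eq_transpose_of_trivial] at this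

lemma _root_.Matrix.PosSemidef.quadForm_nonneg {A : Mat d} (hA : A.PosSemidef) (v : Fin d → ℝ) :
    0 ≤ quadForm A v := by
  simpa [quadForm] using hA.dotProduct_mulVec_nonneg v

lemma _root_.Matrix.PosDef.quadForm_pos {A : Mat d} (hA : A.PosDef) {v : Fin d → ℝ} (hv : v ≠ 0) :
    0 < quadForm A v := by
  simpa [quadForm] using hA.dotProduct_mulVec_pos hv

lemma _root_.Matrix.PosDef.isSymm {A : Mat d} (hA : A.PosDef) : A.IsSymm :=
  hA.posSemidef.isSymm

lemma _root_.Matrix.PosDef.mulVec_inv_mulVec {A : Mat d} (hA : A.PosDef) (v : Fin d → ℝ) :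
    A *ᵥ (A⁻¹ *ᵥ v) = v := by
  rw [mulVec_mulVec, mul_nonsing_inv _ ((isUnit_iff_isUnit_det A).1 hA.isUnit), one_mulVec]

lemma posDef_of_le {A B : Mat d} (hA : A.PosDef) (hB : B.IsSymm)
    (h : ∀ v, quadForm A v ≤ quadForm B v) : B.PosDef :=
  posDef_of_lt hB fun v hv => (hA.quadForm_pos hv).trans_le (h v)

lemma quadForm_inv {K : Mat d} (hK : K.PosDef) (v : Fin d → ℝ) :
    quadForm K⁻¹ v = quadForm K (K⁻¹ *ᵥ v) := by
  rw [quadForm, quadForm, hK.mulVec_inv_mulVec, dotProduct_comm]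

/-- Cauchy–Schwarz for the form K, applied to w and K⁻¹v. -/
lemma sq_dotProduct_le {K : Mat d} (hK : K.PosDef) (v w : Fin d → ℝ) :
    (v ⬝ᵥ w) ^ 2 ≤ quadForm K⁻¹ v * quadForm K w := by
  have h := sq_dotProduct_mulVec_le hK.isSymm hK.posSemidef.quadForm_nonneg w (K⁻¹ *ᵥ v)
  rw [hK.mulVec_inv_mulVec, ← quadForm_inv hK, dotProduct_comm] at h
  linarith

/-- Inversion reverses the Loewner order: take w = K'⁻¹v in the dual Cauchy–Schwarz inequality and
cancel one factor ⟨v, K'⁻¹v⟩. -/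
lemma quadForm_inv_le {K K' : Mat d} {c : ℝ} (hK : K.PosDef) (hK' : K'.PosDef)
    (h : ∀ v, quadForm K v ≤ c * quadForm K' v) (v : Fin d → ℝ) :
    quadForm K'⁻¹ v ≤ c * quadForm K⁻¹ v := by
  have h1 := sq_dotProduct_le hK v (K'⁻¹ *ᵥ v)
  have h2 := h (K'⁻¹ *ᵥ v)
  rw [← quadForm_inv hK'] at h2
  have h3 : 0 ≤ quadForm K⁻¹ v := hK.inv.posSemidef.quadForm_nonneg v
  rcases (hK'.inv.posSemidef.quadForm_nonneg v).eq_or_lt with h0 | h0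
  · rw [← h0] at h2 ⊢
    have h4 := hK.posSemidef.quadForm_nonneg (K'⁻¹ *ᵥ v)
    by_cases hv : v = 0
    · simp [hv, quadForm_zero_right]
    · exact absurd h0 (hK'.inv.quadForm_pos hv).ne
  · change quadForm K'⁻¹ v ^ 2 ≤ _ at h1
    have h4 : quadForm K'⁻¹ v ^ 2 ≤ quadForm K⁻¹ v * (c * quadForm K'⁻¹ v) :=
      h1.trans (mul_le_mul_of_nonneg_left h2 h3)
    nlinarith

/-- Writing B as a sum of rank-one terms w wᵀ turns the trace into a sum of values ⟨w, Cw⟩. -/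
lemma trace_mul_nonneg {C B : Mat d} (hC : C.PosSemidef) (hB : B.PosSemidef) :
    0 ≤ (C * B).trace := by
  obtain ⟨m, w, rfl⟩ := posSemidef_iff_eq_sum_vecMulVec.1 hB
  rw [Matrix.mul_sum, trace_sum]
  refine Finset.sum_nonneg fun i _ => ?_
  rw [mul_vecMulVec, trace_vecMulVec, dotProduct_comm, star_trivial]
  exact hC.quadForm_nonneg (w i)

lemma trace_mul_le {C C' B : Mat d} (hC : C.IsSymm) (hC' : C'.IsSymm)
    (h : ∀ v, quadForm C v ≤ quadForm C' v) (hB : B.PosSemidef) :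
    (C * B).trace ≤ (C' * B).trace := by
  have := trace_mul_nonneg (C := C' - C) (posSemidef_of_nonneg (hC'.sub hC) fun v => by
    rw [quadForm_sub]; linarith [h v]) hB
  rw [sub_mul, trace_sub] at this
  linarith

lemma trace_mul_vecMulVec (C : Mat d) (a b : Fin d → ℝ) :
    (C * vecMulVec a b).trace = b ⬝ᵥ (C *ᵥ a) := by
  rw [mul_vecMulVec, trace_vecMulVec, dotProduct_comm]

/-! ### BFGS updates: domination and decrease of the trace error. -/

section BFGS

variable {B K : Mat d}

lemma bfgs_isSymm (hB : B.IsSymm) (hK : K.IsSymm) (u : Fin d → ℝ) : (bfgs B K u).IsSymm := by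
  rw [bfgs, vecMul_eq_mulVec_of_isSymm hB, vecMul_eq_mulVec_of_isSymm hK]
  refine (hB.sub ?_).add ?_ <;>
  · rw [IsSymm, transpose_smul, transpose_vecMulVec]

lemma bfgs_zero (B K : Mat d) : bfgs B K 0 = B := by
  simp [bfgs]

lemma quadForm_bfgs (hB : B.IsSymm) (hK : K.IsSymm) (u v : Fin d → ℝ) :
    quadForm (bfgs B K u) v = quadForm B v - (quadForm B u)⁻¹ * (u ⬝ᵥ (B *ᵥ v)) ^ 2
      + (quadForm K u)⁻¹ * (u ⬝ᵥ (K *ᵥ v)) ^ 2 := by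
  have key : ∀ {A : Mat d}, A.IsSymm →
      quadForm (vecMulVec (A *ᵥ u) (u ᵥ* A)) v = (u ⬝ᵥ (A *ᵥ v)) ^ 2 := by
    intro A hA
    rw [quadForm, vecMul_eq_mulVec_of_isSymm hA, vecMulVec_mulVec, dotProduct_comm (A *ᵥ u) v,
      dotProduct_mulVec_comm_of_isSymm hA u v]
    simp [dotProduct_mulVec_comm_of_isSymm hA v u, pow_two]
  rw [bfgs, quadForm_add, quadForm_sub, quadForm_smul, quadForm_smul, key hB, key hK]

/-- Removing the rank-one term from B leaves the minimum of the B-form over the line v - ℝu. There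
the K-form is smaller, and the added K-term makes up for moving along the line. -/
lemma le_quadForm_bfgs (hB : B.IsSymm) (hK : K.PosDef)
    (hKB : ∀ v, quadForm K v ≤ quadForm B v) (u v : Fin d → ℝ) :
    quadForm K v ≤ quadForm (bfgs B K u) v := by
  by_cases hu : u = 0
  · rw [hu, bfgs_zero]; exact hKB v
  have hKu := hK.quadForm_pos hu
  have hBu : 0 < quadForm B u := hKu.trans_le (hKB u)
  rw [quadForm_bfgs hB hK.isSymm]
  set b := quadForm B u
  set k := quadForm K u
  set p := u ⬝ᵥ (B *ᵥ v)
  set q := u ⬝ᵥ (K *ᵥ v)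
  -- The multiple b⁻¹p minimizes the B-form along the line; the leftover is the square in `h2`.
  have h := hKB (v - (b⁻¹ * p) • u)
  rw [quadForm_sub_smul hB, quadForm_sub_smul hK.isSymm] at h
  have h1 : quadForm B v - 2 * (b⁻¹ * p) * p + (b⁻¹ * p) ^ 2 * b
      = quadForm B v - b⁻¹ * p ^ 2 := by field_simp; ring
  have h2 : 0 ≤ k * (b⁻¹ * p - k⁻¹ * q) ^ 2 := by positivity
  have h3 : k * (b⁻¹ * p - k⁻¹ * q) ^ 2
      = (b⁻¹ * p) ^ 2 * k - 2 * (b⁻¹ * p) * q + k⁻¹ * q ^ 2 := by field_simp; ring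
  linarith

/-- The added term has weighted trace exactly 1; Cauchy–Schwarz bounds the removed one below by the
ratio that the greedy choice maximizes. -/
lemma trace_inv_mul_bfgs_le (hB : B.IsSymm) (hK : K.PosDef)
    (hKB : ∀ v, quadForm K v ≤ quadForm B v) {u : Fin d → ℝ} (hu : u ≠ 0) :
    (K⁻¹ * bfgs B K u).trace ≤ (K⁻¹ * B).trace - quadForm B u / quadForm K u + 1 := by
  have hKu := hK.quadForm_pos hu
  have hBu : 0 < quadForm B u := hKu.trans_le (hKB u)
  have h1 : (K⁻¹ * bfgs B K u).trace = (K⁻¹ * B).trace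
      - (quadForm B u)⁻¹ * quadForm K⁻¹ (B *ᵥ u) + 1 := by
    rw [bfgs, vecMul_eq_mulVec_of_isSymm hB, vecMul_eq_mulVec_of_isSymm hK.isSymm, mul_add,
      mul_sub, trace_add, trace_sub, Matrix.mul_smul, Matrix.mul_smul, trace_smul, trace_smul,
      trace_mul_vecMulVec, trace_mul_vecMulVec]
    have : (K *ᵥ u) ⬝ᵥ (K⁻¹ *ᵥ (K *ᵥ u)) = quadForm K u := by
      rw [mulVec_mulVec, nonsing_inv_mul _ ((isUnit_iff_isUnit_det K).1 hK.isUnit), one_mulVec,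
        dotProduct_comm, quadForm]
    rw [this, smul_eq_mul, smul_eq_mul, inv_mul_cancel₀ hKu.ne']
    rfl
  have h2 := sq_dotProduct_le hK (B *ᵥ u) u
  rw [dotProduct_comm] at h2
  change quadForm B u ^ 2 ≤ _ at h2
  have h3 : quadForm B u / quadForm K u ≤ (quadForm B u)⁻¹ * quadForm K⁻¹ (B *ᵥ u) := by
    rw [div_le_iff₀ hKu]
    field_simp
    linarith
  linarith

lemma trace_inv_mul_bfgs_le_trace (hB : B.IsSymm) (hK : K.PosDef)
    (hKB : ∀ v, quadForm K v ≤ quadForm B v) (u : Fin d → ℝ) :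
    (K⁻¹ * bfgs B K u).trace ≤ (K⁻¹ * B).trace := by
  by_cases hu : u = 0
  · rw [hu, bfgs_zero]
  have h1 := trace_inv_mul_bfgs_le hB hK hKB hu
  have h2 : 1 ≤ quadForm B u / quadForm K u := by
    rw [one_le_div (hK.quadForm_pos hu)]; exact hKB u
  linarith

lemma sigmaErr_eq (hK : K.PosDef) : sigmaErr B K = (K⁻¹ * B).trace - d := by
  rw [sigmaErr, hK.inv.isSymm.eq, mul_sub, trace_sub,
    nonsing_inv_mul _ ((isUnit_iff_isUnit_det K).1 hK.isUnit), trace_one, Fintype.card_fin]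

variable {μ L : ℝ}

lemma sigmaErr_le_trace (hμ : 0 < μ) (hB : B.IsSymm) (hK : K.PosDef)
    (hKB : ∀ v, quadForm K v ≤ quadForm B v) (hμK : ∀ v, μ * (v ⬝ᵥ v) ≤ quadForm K v) :
    μ * sigmaErr B K ≤ (B - K).trace := by
  have h := trace_mul_le (C := K⁻¹) (C' := μ⁻¹ • 1) (B := B - K) hK.inv.isSymm
    (isSymm_one.smul _) (fun v => by
      have := quadForm_inv_le (K := 1) (K' := K) (c := μ⁻¹) PosDef.one hK (fun v => by
        rw [quadForm_one, le_inv_mul_iff₀ hμ]; exact hμK v) v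
      rwa [inv_one, ← quadForm_smul] at this)
    (posSemidef_of_nonneg (hB.sub hK.isSymm) fun v => by rw [quadForm_sub]; linarith [hKB v])
  rw [sigmaErr, hK.inv.isSymm.eq]
  rw [smul_mul, one_mul, trace_smul, smul_eq_mul, le_inv_mul_iff₀ hμ] at h
  exact h

lemma trace_le_sigmaErr (hB : B.IsSymm) (hK : K.PosDef)
    (hKB : ∀ v, quadForm K v ≤ quadForm B v) (hKL : ∀ v, quadForm K v ≤ L * (v ⬝ᵥ v)) :
    (B - K).trace ≤ L * sigmaErr B K := by
  have h := trace_mul_le (C := 1) (C' := L • K⁻¹) (B := B - K)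
    isSymm_one (hK.inv.isSymm.smul _) (fun v => by
      have := quadForm_inv_le (K := K) (K' := 1) (c := L) hK PosDef.one (fun v => by
        rw [quadForm_one]; exact hKL v) v
      rwa [inv_one, ← quadForm_smul] at this)
    (posSemidef_of_nonneg (hB.sub hK.isSymm) fun v => by rw [quadForm_sub]; linarith [hKB v])
  rw [sigmaErr, hK.inv.isSymm.eq]
  rwa [one_mul, smul_mul, trace_smul, smul_eq_mul] at h

/-- With m the maximal ratio, every diagonal entry of B - K is at most L(m - 1), so μσ ≤ Tr(B - K) ≤
dL(m - 1). The update lowers σ by at least m - 1, a fraction μ/(dL) of it. -/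
lemma sigmaErr_bfgs_greedy_le (hμ : 0 < μ) (hL : 0 < L) (hB : B.IsSymm) (hK : K.PosDef)
    (hKB : ∀ v, quadForm K v ≤ quadForm B v) (hμK : ∀ v, μ * (v ⬝ᵥ v) ≤ quadForm K v)
    (hKL : ∀ v, quadForm K v ≤ L * (v ⬝ᵥ v)) {u : Fin d → ℝ} (hu : IsGreedyVector B K u) :
    sigmaErr (bfgs B K u) K ≤ (1 - μ / (d * L)) * sigmaErr B K := by
  obtain ⟨k, rfl, hmax⟩ := hu
  have hd : (0 : ℝ) < d := by exact_mod_cast k.pos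
  have hne : ∀ j : Fin d, (Pi.single j 1 : Fin d → ℝ) ≠ 0 := fun j => by simp
  set m := quadForm B (Pi.single k 1) / quadForm K (Pi.single k 1) with hm
  have h1 := trace_inv_mul_bfgs_le hB hK hKB (hne k)
  rw [← hm] at h1
  have h2 : ∀ j, (B - K) j j ≤ L * (m - 1) := by
    intro j
    have hKj := hK.quadForm_pos (hne j)
    have h3 := hmax j
    rw [div_le_iff₀ hKj] at h3
    have h4 := hKL (Pi.single j 1)
    have h5 : 1 ≤ m := by rw [hm, one_le_div (hK.quadForm_pos (hne k))]; exact hKB _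
    simp only [quadForm_single, single_one_dotProduct, Pi.single_eq_same, mul_one] at h3 h4
    rw [Matrix.sub_apply]
    nlinarith
  have h3 : (B - K).trace ≤ d * (L * (m - 1)) := by
    rw [trace]
    refine (Finset.sum_le_sum fun j _ => h2 j).trans ?_
    simp
  have h4 := sigmaErr_le_trace hμ hB hK hKB hμK
  have h5 : μ / (d * L) * sigmaErr B K ≤ m - 1 := by
    rw [div_mul_eq_mul_div, div_le_iff₀ (by positivity)]
    linarith
  rw [sigmaErr_eq hK] at h5 ⊢
  rw [sigmaErr_eq hK]
  linarith

end BFGS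

/-- The effect of the corrected classical BFGS step, when the Hessians `H`, `H'` at both ends and
the averaged Hessian `K` agree up to the factor `1 + β`. -/
lemma corrected_bfgs {H H' K B : Mat d} {β : ℝ} (hβ : 0 ≤ β) (hH : H.PosDef) (hH' : H'.PosDef)
    (hK : K.PosDef) (hB : B.IsSymm) (hHB : ∀ v, quadForm H v ≤ quadForm B v)
    (hKH : ∀ v, quadForm K v ≤ (1 + β) * quadForm H v)
    (hHK : ∀ v, quadForm H v ≤ (1 + β) * quadForm K v)
    (hKH' : ∀ v, quadForm K v ≤ (1 + β) * quadForm H' v)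
    (hHK' : ∀ v, quadForm H' v ≤ (1 + β) * quadForm K v) (s : Fin d → ℝ) :
    (bfgs ((1 + β) ^ 2 • B) ((1 + β) • K) s).IsSymm ∧
    (∀ v, quadForm H' v ≤ quadForm (bfgs ((1 + β) ^ 2 • B) ((1 + β) • K) s) v) ∧
    (H'⁻¹ * bfgs ((1 + β) ^ 2 • B) ((1 + β) • K) s).trace ≤ (1 + β) ^ 4 * (H⁻¹ * B).trace := by
  -- The order hypotheses give H ≼ P ≼ A and H' ≼ P ≼ (1 + β)²H'. Passing from H'⁻¹ to P⁻¹ costs (1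
  -- + β)², and the scaling of B costs another (1 + β)².
  set P := (1 + β) • K with hP
  set A := (1 + β) ^ 2 • B with hA
  have hPd : P.PosDef := hK.smul (by linarith)
  have hAs : A.IsSymm := hB.smul _
  have hPA : ∀ v, quadForm P v ≤ quadForm A v := fun v => by
    rw [hP, hA, quadForm_smul, quadForm_smul, pow_two, mul_assoc]
    have : 0 ≤ 1 + β := by linarith
    exact mul_le_mul_of_nonneg_left
      ((hKH v).trans (mul_le_mul_of_nonneg_left (hHB v) this)) this
  have hQs := bfgs_isSymm hAs hPd.isSymm s
  have hPQ := le_quadForm_bfgs hAs hPd hPA s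
  have hH'P : ∀ v, quadForm H' v ≤ quadForm P v := fun v => by
    rw [hP, quadForm_smul]; exact hHK' v
  have hQd : (bfgs A P s).PosSemidef := (posDef_of_le hPd hQs hPQ).posSemidef
  have hAd : A.PosSemidef := (posDef_of_le hPd hAs hPA).posSemidef
  refine ⟨hQs, fun v => (hH'P v).trans (hPQ v), ?_⟩
  have h1 : (H'⁻¹ * bfgs A P s).trace ≤ (((1 + β) ^ 2 • P⁻¹) * bfgs A P s).trace := by
    refine trace_mul_le hH'.inv.isSymm (hPd.inv.isSymm.smul _) (fun v => ?_) hQd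
    rw [quadForm_smul]
    refine quadForm_inv_le hPd hH' (fun v => ?_) v
    rw [hP, quadForm_smul, pow_two, mul_assoc]
    exact mul_le_mul_of_nonneg_left (hKH' v) (by linarith)
  have h2 := trace_inv_mul_bfgs_le_trace hAs hPd hPA s
  have h3 : (P⁻¹ * A).trace ≤ (H⁻¹ * A).trace := by
    refine trace_mul_le hPd.inv.isSymm hH.inv.isSymm (fun v => ?_) hAd
    have := quadForm_inv_le (c := 1) hH hPd (fun v => by
      rw [hP, quadForm_smul, one_mul]; exact hHK v) v
    rwa [one_mul] at this
  have h4 : (H⁻¹ * A).trace = (1 + β) ^ 2 * (H⁻¹ * B).trace := by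
    rw [hA, Matrix.mul_smul, trace_smul, smul_eq_mul]
  rw [smul_mul, trace_smul, smul_eq_mul] at h1
  calc _ ≤ _ := h1
    _ ≤ (1 + β) ^ 2 * ((1 + β) ^ 2 * (H⁻¹ * B).trace) :=
        mul_le_mul_of_nonneg_left (by linarith) (by positivity)
    _ = _ := by ring

/-! ### Euclidean norm estimates for matrix actions. -/

lemma norm_sq_eq_dotProduct (v : Vec d) : ‖v‖ ^ 2 = v.ofLp ⬝ᵥ v.ofLp := by
  rw [EuclideanSpace.real_norm_sq_eq, dotProduct]
  simp [pow_two]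

lemma dotProduct_le_norm_mul_norm (v w : Vec d) : v.ofLp ⬝ᵥ w.ofLp ≤ ‖v‖ * ‖w‖ := by
  have := real_inner_le_norm v w
  rwa [EuclideanSpace.inner_eq_star_dotProduct, star_trivial, dotProduct_comm] at this

/-- Cauchy–Schwarz in each coordinate ⟨eᵢ, Av⟩ gives ‖Av‖² ≤ Tr(A)⟨v, Av⟩; then one factor ‖Av‖
cancels. -/
lemma norm_mulVec_le_trace_mul {A : Mat d} (hA : A.PosSemidef) (v : Vec d) :
    ‖(WithLp.toLp 2 (A *ᵥ v.ofLp) : Vec d)‖ ≤ A.trace * ‖v‖ := by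
  set w : Vec d := WithLp.toLp 2 (A *ᵥ v.ofLp) with hw
  have h1 : ‖w‖ ^ 2 ≤ A.trace * quadForm A v.ofLp := by
    rw [EuclideanSpace.real_norm_sq_eq, trace, Finset.sum_mul]
    refine Finset.sum_le_sum fun i _ => ?_
    have := sq_dotProduct_mulVec_le hA.isSymm hA.quadForm_nonneg (Pi.single i 1) v.ofLp
    rwa [single_one_dotProduct, quadForm_single] at this
  have h2 : quadForm A v.ofLp ≤ ‖v‖ * ‖w‖ := dotProduct_le_norm_mul_norm v w
  have h3 := hA.trace_nonneg
  by_cases h0 : ‖w‖ = 0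
  · rw [h0]; positivity
  have h4 : 0 < ‖w‖ := lt_of_le_of_ne (norm_nonneg _) (Ne.symm h0)
  have h5 : ‖w‖ ^ 2 ≤ A.trace * (‖v‖ * ‖w‖) := h1.trans (mul_le_mul_of_nonneg_left h2 h3)
  nlinarith

lemma mul_norm_inv_mulVec_le {S : Mat d} {m : ℝ} (hS : S.PosDef)
    (h : ∀ v, m * (v ⬝ᵥ v) ≤ quadForm S v) (v : Vec d) :
    m * ‖(WithLp.toLp 2 (S⁻¹ *ᵥ v.ofLp) : Vec d)‖ ≤ ‖v‖ := by
  set w : Vec d := WithLp.toLp 2 (S⁻¹ *ᵥ v.ofLp) with hw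
  have h1 := h w.ofLp
  rw [← norm_sq_eq_dotProduct, quadForm, hw, hS.mulVec_inv_mulVec] at h1
  have h2 := h1.trans (dotProduct_le_norm_mul_norm w v)
  by_cases h0 : ‖w‖ = 0
  · rw [h0]; simp
  have h4 : 0 < ‖w‖ := lt_of_le_of_ne (norm_nonneg _) (Ne.symm h0)
  nlinarith

end SIQN

/-! ### Hessians and averaged Hessians as quadratic forms. -/

namespace SIQN

open Matrix Filter Topology

variable {d : ℕ} {f : Vec d → ℝ} {μ L Lt : ℝ}

lemma contDiff_gradient (hf : ContDiff ℝ 2 f) : ContDiff ℝ 1 (gradient f) := by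
  have h : ContDiff ℝ 1 (fderiv ℝ f) := hf.fderiv_right (by norm_num)
  exact (InnerProductSpace.toDual ℝ (Vec d)).symm.toContinuousLinearEquiv.contDiff.comp h

lemma toEuclideanCLM_hessian (f : Vec d → ℝ) (x : Vec d) :
    Matrix.toEuclideanCLM (n := Fin d) (𝕜 := ℝ) (hessian f x) = fderiv ℝ (gradient f) x := by
  apply ContinuousLinearMap.coe_injective
  refine (EuclideanSpace.basisFun (Fin d) ℝ).toBasis.ext fun j => ?_
  ext i
  simp [hessian]

lemma hessian_mulVec (f : Vec d → ℝ) (x v : Vec d) :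
    hessian f x *ᵥ v.ofLp = (fderiv ℝ (gradient f) x v).ofLp := by
  rw [← toEuclideanCLM_hessian, Matrix.ofLp_toEuclideanCLM]

lemma dotProduct_hessian_mulVec (f : Vec d → ℝ) (x v w : Vec d) :
    w.ofLp ⬝ᵥ (hessian f x *ᵥ v.ofLp) = inner ℝ (fderiv ℝ (gradient f) x v) w := by
  rw [hessian_mulVec, EuclideanSpace.inner_eq_star_dotProduct, star_trivial]

lemma specNorm_hessian_sub (f : Vec d → ℝ) (x y : Vec d) :
    specNorm (hessian f y - hessian f x) =
      ‖fderiv ℝ (gradient f) y - fderiv ℝ (gradient f) x‖ := by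
  rw [specNorm, map_sub, toEuclideanCLM_hessian, toEuclideanCLM_hessian]

/-- Identifies the Jacobian of the gradient with the second derivative, so that symmetry of the
latter passes to the Hessian matrix. -/
lemma inner_fderiv_gradient (hf : ContDiff ℝ 2 f) (x v w : Vec d) :
    inner ℝ (fderiv ℝ (gradient f) x v) w = fderiv ℝ (fderiv ℝ f) x v w := by
  have h : DifferentiableAt ℝ (gradient f) x :=
    (contDiff_gradient hf).differentiable (by norm_num) x
  have h1 : fderiv ℝ f = fun y => InnerProductSpace.toDual ℝ (Vec d) (gradient f y) := by
    funext y; rw [toDual_gradient]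
  have h2 : HasFDerivAt (fderiv ℝ f)
      ((InnerProductSpace.toDual ℝ (Vec d)).toContinuousLinearEquiv.toContinuousLinearMap.comp
        (fderiv ℝ (gradient f) x)) x := by
    rw [h1]
    exact (InnerProductSpace.toDual ℝ (Vec d)).toContinuousLinearEquiv.hasFDerivAt.comp x
      h.hasFDerivAt
  rw [h2.fderiv]
  simp

lemma hessian_isSymm (hf : ContDiff ℝ 2 f) (x : Vec d) : (hessian f x).IsSymm := by
  have hs : IsSymmSndFDerivAt ℝ f x :=
    hf.contDiffAt.isSymmSndFDerivAt (by simp)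
  ext i j
  have key : ∀ i j : Fin d, hessian f x i j =
      fderiv ℝ (fderiv ℝ f) x (EuclideanSpace.single j 1) (EuclideanSpace.single i 1) := by
    intro i j
    rw [← inner_fderiv_gradient hf]
    simp [hessian, EuclideanSpace.inner_single_right]
  rw [transpose_apply, key, key]
  exact hs _ _

lemma continuous_hessian_apply (hf : ContDiff ℝ 2 f) (i j : Fin d) :
    Continuous fun x => hessian f x i j := by
  have h : Continuous (fderiv ℝ (gradient f)) :=
    (contDiff_gradient hf).continuous_fderiv (by norm_num)
  have h1 : Continuous fun x => fderiv ℝ (gradient f) x (EuclideanSpace.single j 1) :=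
    h.clm_apply continuous_const
  exact (EuclideanSpace.proj i : Vec d →L[ℝ] ℝ).continuous.comp h1

lemma inner_gradient_sub_bounds (h : StronglyConvexSmooth μ L f) (x y : Vec d) :
    μ * ‖y - x‖ ^ 2 ≤ inner ℝ (gradient f y - gradient f x) (y - x) ∧
      inner ℝ (gradient f y - gradient f x) (y - x) ≤ L * ‖y - x‖ ^ 2 := by
  have h1 := h x y
  have h2 := h y x
  rw [norm_sub_rev x y, ← neg_sub y x, inner_neg_right] at h2
  rw [inner_sub_left]
  constructor <;> linarith [h1.1, h1.2, h2.1, h2.2]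

/-- The form is the derivative of t ↦ ⟨∇f(x + tw), w⟩ at 0, and monotonicity of the gradient bounds
its difference quotients. -/
lemma quadForm_hessian_bounds (hf : ContDiff ℝ 2 f) (h : StronglyConvexSmooth μ L f) (x : Vec d)
    (v : Fin d → ℝ) :
    μ * (v ⬝ᵥ v) ≤ quadForm (hessian f x) v ∧ quadForm (hessian f x) v ≤ L * (v ⬝ᵥ v) := by
  set w : Vec d := WithLp.toLp 2 v with hw
  have hq : quadForm (hessian f x) v = inner ℝ (fderiv ℝ (gradient f) x w) w :=
    dotProduct_hessian_mulVec f x w w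
  have hv : v ⬝ᵥ v = ‖w‖ ^ 2 := (norm_sq_eq_dotProduct w).symm
  have hd : HasDerivAt (fun t : ℝ => inner ℝ (gradient f (x + t • w)) w)
      (inner ℝ (fderiv ℝ (gradient f) x w) w) 0 := by
    have hg : HasFDerivAt (gradient f) (fderiv ℝ (gradient f) x) (x + (0 : ℝ) • w) := by
      rw [zero_smul, add_zero]
      exact ((contDiff_gradient hf).differentiable (by norm_num) x).hasFDerivAt
    have hl : HasDerivAt (fun t : ℝ => x + t • w) w 0 := by
      simpa using ((hasDerivAt_id (0 : ℝ)).smul_const w).const_add x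
    have := (hg.comp_hasDerivAt (0 : ℝ) hl).inner ℝ (hasDerivAt_const (0 : ℝ) w)
    simpa using this
  have ht := hd.tendsto_slope_zero_right
  have hb : ∀ t : ℝ, 0 < t → μ * ‖w‖ ^ 2 ≤
      t⁻¹ • (inner ℝ (gradient f (x + (0 + t) • w)) w -
        inner ℝ (gradient f (x + (0 : ℝ) • w)) w) ∧
      t⁻¹ • (inner ℝ (gradient f (x + (0 + t) • w)) w -
        inner ℝ (gradient f (x + (0 : ℝ) • w)) w) ≤ L * ‖w‖ ^ 2 := by
    intro t ht
    have := inner_gradient_sub_bounds h x (x + t • w)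
    rw [add_sub_cancel_left, norm_smul, inner_smul_right, mul_pow, Real.norm_eq_abs, sq_abs]
      at this
    rw [zero_add, zero_smul, add_zero, ← inner_sub_left, smul_eq_mul, inv_mul_eq_div,
      le_div_iff₀ ht, div_le_iff₀ ht]
    constructor <;> refine le_of_mul_le_mul_left ?_ ht <;> linarith [this.1, this.2]
  rw [hq, hv]
  exact ⟨ge_of_tendsto ht (eventually_mem_nhdsWithin.mono fun t ht => (hb t ht).1),
    le_of_tendsto ht (eventually_mem_nhdsWithin.mono fun t ht => (hb t ht).2)⟩

lemma dotProduct_self_nonneg_real (v : Fin d → ℝ) : 0 ≤ v ⬝ᵥ v := by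
  rw [← quadForm_one]; exact PosDef.one.posSemidef.quadForm_nonneg v

lemma posDef_of_mul_dotProduct_le {A : Mat d} (hμ : 0 < μ) (hA : A.IsSymm)
    (h : ∀ v, μ * (v ⬝ᵥ v) ≤ quadForm A v) : A.PosDef :=
  posDef_of_lt hA fun v hv => (mul_pos hμ
    ((dotProduct_self_nonneg_real v).lt_of_ne' (by simpa using hv))).trans_le (h v)

lemma hessian_posDef (hμ : 0 < μ) (hf : ContDiff ℝ 2 f) (h : StronglyConvexSmooth μ L f)
    (x : Vec d) : (hessian f x).PosDef :=
  posDef_of_mul_dotProduct_le hμ (hessian_isSymm hf x) fun v => (quadForm_hessian_bounds hf h x v).1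

lemma HessianLipschitz.nonneg (hd : 0 < d) (h : HessianLipschitz Lt f) : 0 ≤ Lt := by
  have h1 := h 0 (EuclideanSpace.single ⟨0, hd⟩ 1)
  have h2 : 0 ≤ specNorm (hessian f (EuclideanSpace.single ⟨0, hd⟩ 1) - hessian f 0) :=
    norm_nonneg _
  simpa using h2.trans h1

lemma HessianLipschitz.quadForm_le (h : HessianLipschitz Lt f) (x y : Vec d) (v : Fin d → ℝ) :
    quadForm (hessian f y) v ≤ quadForm (hessian f x) v + Lt * ‖y - x‖ * (v ⬝ᵥ v) := by
  set w : Vec d := WithLp.toLp 2 v with hw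
  have hq : quadForm (hessian f y - hessian f x) v =
      inner ℝ w (Matrix.toEuclideanCLM (n := Fin d) (𝕜 := ℝ) (hessian f y - hessian f x) w) :=
    (Matrix.inner_toEuclideanCLM _ w w).symm
  have h1 := real_inner_le_norm w
    (Matrix.toEuclideanCLM (n := Fin d) (𝕜 := ℝ) (hessian f y - hessian f x) w)
  have h2 := ContinuousLinearMap.le_opNorm
    (Matrix.toEuclideanCLM (n := Fin d) (𝕜 := ℝ) (hessian f y - hessian f x)) w
  have h3 := h x y
  rw [specNorm] at h3
  have h4 : v ⬝ᵥ v = ‖w‖ ^ 2 := (norm_sq_eq_dotProduct w).symm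
  rw [quadForm_sub] at hq
  have h5 : ‖w‖ * ‖Matrix.toEuclideanCLM (n := Fin d) (𝕜 := ℝ) (hessian f y - hessian f x) w‖
      ≤ ‖w‖ * (Lt * ‖y - x‖ * ‖w‖) :=
    mul_le_mul_of_nonneg_left
      (h2.trans (mul_le_mul_of_nonneg_right h3 (norm_nonneg _))) (norm_nonneg _)
  rw [h4]
  nlinarith

/-- The mean value inequality on the segment, after subtracting the derivative at x. It gives Lt
rather than the sharp Lt/2, which is enough here. -/
lemma norm_gradient_sub_sub_le (hf : ContDiff ℝ 2 f) (hd : 0 < d) (h : HessianLipschitz Lt f)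
    (x y : Vec d) :
    ‖gradient f y - gradient f x - fderiv ℝ (gradient f) x (y - x)‖ ≤ Lt * ‖y - x‖ ^ 2 := by
  have hLt := h.nonneg hd
  have := (convex_segment x y).norm_image_sub_le_of_norm_fderiv_le' (𝕜 := ℝ) (f := gradient f)
    (φ := fderiv ℝ (gradient f) x) (C := Lt * ‖y - x‖) (x := x) (y := y)
    (fun z _ => (contDiff_gradient hf).differentiable (by norm_num) z)
    (fun z hz => by
      rw [← specNorm_hessian_sub]
      refine (h x z).trans (mul_le_mul_of_nonneg_left ?_ hLt)
      obtain ⟨a, b, ha, hb, hab, rfl⟩ := hz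
      have : a • x + b • y - x = b • (y - x) := by
        rw [← eq_sub_iff_add_eq] at hab; rw [hab]; module
      rw [this, norm_smul, Real.norm_of_nonneg hb]
      exact mul_le_of_le_one_left (norm_nonneg _) (by linarith))
    (left_mem_segment ℝ x y) (right_mem_segment ℝ x y)
  rwa [mul_assoc, ← pow_two] at this

lemma continuous_quadForm_hessian (hf : ContDiff ℝ 2 f) (v : Fin d → ℝ) :
    Continuous fun x => quadForm (hessian f x) v := by
  simp only [quadForm, dotProduct, mulVec]
  exact continuous_finsetSum _ fun i _ => continuous_const.mul
    (continuous_finsetSum _ fun j _ => (continuous_hessian_apply hf i j).mul continuous_const)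

lemma avgHessian_isSymm (hf : ContDiff ℝ 2 f) (a b : Vec d) : (avgHessian f a b).IsSymm := by
  ext i j
  simp only [avgHessian, transpose_apply, of_apply]
  congr 1
  funext τ
  exact (hessian_isSymm hf _).apply i j

lemma quadForm_avgHessian (hf : ContDiff ℝ 2 f) (a b : Vec d) (v : Fin d → ℝ) :
    quadForm (avgHessian f a b) v =
      ∫ τ in (0 : ℝ)..1, quadForm (hessian f (a + τ • (b - a))) v := by
  have hc : ∀ i j : Fin d, Continuous fun τ : ℝ => hessian f (a + τ • (b - a)) i j := fun i j =>
    (continuous_hessian_apply hf i j).comp (by fun_prop)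
  simp only [quadForm, dotProduct, mulVec, avgHessian, of_apply]
  rw [intervalIntegral.integral_finsetSum]
  · refine Finset.sum_congr rfl fun i _ => ?_
    rw [intervalIntegral.integral_const_mul, intervalIntegral.integral_finsetSum]
    · simp only [intervalIntegral.integral_mul_const]
    · exact fun j _ => ((hc i j).mul continuous_const).intervalIntegrable _ _
  · exact fun i _ => (continuous_const.mul (continuous_finsetSum _ fun j _ =>
      (hc i j).mul continuous_const)).intervalIntegrable _ _

lemma integral_affine (p q : ℝ) : ∫ τ in (0 : ℝ)..1, (p + τ * q) = p + q / 2 := by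
  rw [intervalIntegral.integral_add (by simp)
    ((by fun_prop : Continuous fun τ : ℝ => τ * q).intervalIntegrable _ _),
    intervalIntegral.integral_mul_const]
  simp; ring

/-- An affine bound for the Hessian along a segment gives a bound for the averaged Hessian. -/
lemma quadForm_avgHessian_le (hf : ContDiff ℝ 2 f) (a b : Vec d) (v : Fin d → ℝ) (p q : ℝ)
    (h : ∀ τ ∈ Set.Icc (0 : ℝ) 1, quadForm (hessian f (a + τ • (b - a))) v ≤ p + τ * q) :
    quadForm (avgHessian f a b) v ≤ p + q / 2 := by
  rw [quadForm_avgHessian hf, ← integral_affine]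
  refine intervalIntegral.integral_mono_on zero_le_one ?_ ?_ h
  · exact ((continuous_quadForm_hessian hf v).comp (by fun_prop)).intervalIntegrable _ _
  · exact (by fun_prop : Continuous fun τ : ℝ => p + τ * q).intervalIntegrable _ _

lemma le_quadForm_avgHessian (hf : ContDiff ℝ 2 f) (a b : Vec d) (v : Fin d → ℝ) (p q : ℝ)
    (h : ∀ τ ∈ Set.Icc (0 : ℝ) 1, p + τ * q ≤ quadForm (hessian f (a + τ • (b - a))) v) :
    p + q / 2 ≤ quadForm (avgHessian f a b) v := by
  rw [quadForm_avgHessian hf, ← integral_affine]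
  refine intervalIntegral.integral_mono_on zero_le_one ?_ ?_ h
  · exact (by fun_prop : Continuous fun τ : ℝ => p + τ * q).intervalIntegrable _ _
  · exact ((continuous_quadForm_hessian hf v).comp (by fun_prop)).intervalIntegrable _ _

/-- The averaged Hessian lies within `Lt / 2 ‖b - a‖` of the Hessians at both ends. -/
lemma avgHessian_bounds (hf : ContDiff ℝ 2 f) (h : HessianLipschitz Lt f) (a b : Vec d)
    (v : Fin d → ℝ) :
    quadForm (avgHessian f a b) v ≤
      quadForm (hessian f a) v + Lt * ‖b - a‖ / 2 * (v ⬝ᵥ v) ∧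
    quadForm (hessian f a) v ≤
      quadForm (avgHessian f a b) v + Lt * ‖b - a‖ / 2 * (v ⬝ᵥ v) ∧
    quadForm (avgHessian f a b) v ≤
      quadForm (hessian f b) v + Lt * ‖b - a‖ / 2 * (v ⬝ᵥ v) ∧
    quadForm (hessian f b) v ≤
      quadForm (avgHessian f a b) v + Lt * ‖b - a‖ / 2 * (v ⬝ᵥ v) := by
  -- Along the segment the deviation is at most τc from the start and (1 - τ)c from the end; both
  -- average to c/2.
  set c := Lt * ‖b - a‖ * (v ⬝ᵥ v) with hc
  have hA : ∀ τ ∈ Set.Icc (0 : ℝ) 1, ‖a + τ • (b - a) - a‖ = τ * ‖b - a‖ := fun τ hτ => by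
    rw [add_sub_cancel_left, norm_smul, Real.norm_of_nonneg hτ.1]
  have hB : ∀ τ ∈ Set.Icc (0 : ℝ) 1, ‖a + τ • (b - a) - b‖ = (1 - τ) * ‖b - a‖ := fun τ hτ => by
    rw [show a + τ • (b - a) - b = -((1 - τ) • (b - a)) by module, norm_neg, norm_smul,
      Real.norm_of_nonneg (by linarith [hτ.2])]
  have e1 := quadForm_avgHessian_le hf a b v (quadForm (hessian f a) v) c fun τ hτ => by
    have := h.quadForm_le a (a + τ • (b - a)) v
    rw [hA τ hτ] at this
    rw [hc]; linarith
  have e2 := le_quadForm_avgHessian hf a b v (quadForm (hessian f a) v) (-c) fun τ hτ => by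
    have := h.quadForm_le (a + τ • (b - a)) a v
    rw [norm_sub_rev, hA τ hτ] at this
    rw [hc]; linarith
  have e3 := quadForm_avgHessian_le hf a b v (quadForm (hessian f b) v + c) (-c) fun τ hτ => by
    have := h.quadForm_le b (a + τ • (b - a)) v
    rw [hB τ hτ] at this
    rw [hc]; linarith
  have e4 := le_quadForm_avgHessian hf a b v (quadForm (hessian f b) v - c) c fun τ hτ => by
    have := h.quadForm_le (a + τ • (b - a)) b v
    rw [norm_sub_rev, hB τ hτ] at this
    rw [hc]; linarith
  refine ⟨?_, ?_, ?_, ?_⟩ <;> linarith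

lemma le_quadForm_avgHessian_of_stronglyConvex (hf : ContDiff ℝ 2 f)
    (h : StronglyConvexSmooth μ L f) (a b : Vec d) (v : Fin d → ℝ) :
    μ * (v ⬝ᵥ v) ≤ quadForm (avgHessian f a b) v := by
  have := le_quadForm_avgHessian hf a b v (μ * (v ⬝ᵥ v)) 0 fun τ _ => by
    rw [mul_zero, add_zero]; exact (quadForm_hessian_bounds hf h _ v).1
  simpa using this

lemma avgHessian_posDef (hμ : 0 < μ) (hf : ContDiff ℝ 2 f) (h : StronglyConvexSmooth μ L f)
    (a b : Vec d) : (avgHessian f a b).PosDef :=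
  posDef_of_mul_dotProduct_le hμ (avgHessian_isSymm hf a b)
    (le_quadForm_avgHessian_of_stronglyConvex hf h a b)

end SIQN

/-! ### The sharpened update. -/

namespace SIQN

open Matrix

section Update

variable {d : ℕ} {f : Vec d → ℝ} {μ L Lt : ℝ}

lemma sqrt_mul_norm_le_localNorm (hf : ContDiff ℝ 2 f) (h : StronglyConvexSmooth μ L f)
    (x y : Vec d) : √μ * ‖y‖ ≤ localNorm f x y := by
  rw [localNorm, ← Real.sqrt_sq (norm_nonneg y), ← Real.sqrt_mul' _ (sq_nonneg _),
    norm_sq_eq_dotProduct]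
  exact Real.sqrt_le_sqrt (quadForm_hessian_bounds hf h x _).1

lemma localNorm_le_sqrt_mul_norm (hf : ContDiff ℝ 2 f) (h : StronglyConvexSmooth μ L f)
    (x y : Vec d) : localNorm f x y ≤ √L * ‖y‖ := by
  rw [localNorm, ← Real.sqrt_sq (norm_nonneg y), ← Real.sqrt_mul' _ (sq_nonneg _),
    norm_sq_eq_dotProduct]
  exact Real.sqrt_le_sqrt (quadForm_hessian_bounds hf h x _).2

lemma rpow_mul_sqrt_mul (hμ : 0 < μ) : μ ^ (-(3 / 2) : ℝ) * √μ * μ = 1 := by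
  rw [Real.sqrt_eq_rpow, ← Real.rpow_add hμ]
  nth_rewrite 2 [← Real.rpow_one μ]
  rw [← Real.rpow_add hμ]
  norm_num

/-- This is what fixes M = Lt μ^(-3/2): one factor √μ converts the Euclidean norm to the local norm,
and one factor μ turns an additive error into a relative one. -/
lemma correction_bound (hμ : 0 < μ) (hLt : 0 ≤ Lt) (hf : ContDiff ℝ 2 f)
    (h : StronglyConvexSmooth μ L f) (a s : Vec d) :
    Lt * ‖s‖ / 2 ≤ Lt * μ ^ (-(3 / 2) : ℝ) / 2 * localNorm f a s * μ := by
  have h1 := sqrt_mul_norm_le_localNorm hf h a s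
  have h2 : 0 ≤ Lt * μ ^ (-(3 / 2) : ℝ) / 2 := by positivity
  calc Lt * ‖s‖ / 2 = Lt * ‖s‖ / 2 * (μ ^ (-(3 / 2) : ℝ) * √μ * μ) := by
        rw [rpow_mul_sqrt_mul hμ, mul_one]
    _ = Lt * μ ^ (-(3 / 2) : ℝ) / 2 * (√μ * ‖s‖) * μ := by ring
    _ ≤ _ := mul_le_mul_of_nonneg_right (mul_le_mul_of_nonneg_left h1 h2) hμ.le

/-- The sharpened update keeps the approximation above the Hessian and contracts the error. -/
lemma SharpenedUpdate.bounds (hμ : 0 < μ) (hL : 0 < L) (hLt : 0 ≤ Lt)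
    (hr : 0 ≤ 1 - μ / (d * L)) (hf : ContDiff ℝ 2 f)
    (h : StronglyConvexSmooth μ L f) (hLip : HessianLipschitz Lt f) {a b : Vec d} {B B' : Mat d}
    (hup : SharpenedUpdate (Lt * μ ^ (-(3 / 2) : ℝ)) f a b B B') (hB : B.IsSymm)
    (hHB : ∀ v, quadForm (hessian f a) v ≤ quadForm B v) :
    B'.IsSymm ∧ (∀ v, quadForm (hessian f b) v ≤ quadForm B' v) ∧
    ∃ β, 0 ≤ β ∧ β ≤ Lt * μ ^ (-(3 / 2) : ℝ) / 2 * √L * ‖b - a‖ ∧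
      sigmaErr B' (hessian f b) ≤
        (1 - μ / (d * L)) * ((1 + β) ^ 4 * (sigmaErr B (hessian f a) + d) - d) := by
  obtain ⟨β, Q, u, hβ, hQ, hu, rfl⟩ := hup
  have hM : 0 ≤ Lt * μ ^ (-(3 / 2) : ℝ) / 2 := by positivity
  have hβ0 : 0 ≤ β := by
    rw [hβ]; exact mul_nonneg hM (Real.sqrt_nonneg _)
  have hHa := hessian_posDef hμ hf h a
  have hHb := hessian_posDef hμ hf h b
  have hK := avgHessian_posDef hμ hf h a b
  have key : ∀ v : Fin d → ℝ, ∀ p, μ * (v ⬝ᵥ v) ≤ p →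
      p + Lt * ‖b - a‖ / 2 * (v ⬝ᵥ v) ≤ (1 + β) * p := fun v p hp => by
    -- A form value p ≥ μ‖v‖² absorbs the additive error Lt‖b - a‖/2 · ‖v‖² into βp.
    have h1 := correction_bound hμ hLt hf h a (b - a)
    rw [← hβ] at h1
    have h2 := mul_le_mul_of_nonneg_right h1 (dotProduct_self_nonneg_real v)
    have h3 := mul_le_mul_of_nonneg_left hp hβ0
    linarith
  have hav := avgHessian_bounds hf hLip a b
  have hKμ := le_quadForm_avgHessian_of_stronglyConvex hf h a b
  obtain ⟨hQs, hQH, hQt⟩ := corrected_bfgs hβ0 hHa hHb hK hB hHB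
    (fun v => (hav v).1.trans (key v _ (quadForm_hessian_bounds hf h a v).1))
    (fun v => (hav v).2.1.trans (key v _ (hKμ v)))
    (fun v => (hav v).2.2.1.trans (key v _ (quadForm_hessian_bounds hf h b v).1))
    (fun v => (hav v).2.2.2.trans (key v _ (hKμ v))) (b - a).ofLp
  rw [← hQ] at hQs hQH hQt
  refine ⟨bfgs_isSymm hQs hHb.isSymm u, le_quadForm_bfgs hQs hHb hQH u, β, hβ0, ?_, ?_⟩
  · rw [hβ, mul_assoc]
    exact mul_le_mul_of_nonneg_left (localNorm_le_sqrt_mul_norm hf h a _) hM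
  · refine (sigmaErr_bfgs_greedy_le hμ hL hQs hHb hQH
      (fun v => (quadForm_hessian_bounds hf h b v).1)
      (fun v => (quadForm_hessian_bounds hf h b v).2) hu).trans ?_
    refine mul_le_mul_of_nonneg_left ?_ hr
    rw [sigmaErr_eq hHb, sigmaErr_eq hHa]
    linarith

end Update

/-! ### One step of the iteration. -/

section Step

variable {n d : ℕ} {f : Fin n → Vec d → ℝ} {μ L Lt : ℝ}

lemma sum_gradient_eq_zero (hn : 0 < n) (hf : ∀ i, ContDiff ℝ 2 (f i)) {xstar : Vec d}
    (hx : ∀ y, (1 / (n : ℝ)) * ∑ i, f i xstar ≤ (1 / (n : ℝ)) * ∑ i, f i y) :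
    ∑ i, gradient (f i) xstar = 0 := by
  have hn' : (0 : ℝ) < 1 / n := by positivity
  have hmin : IsLocalMin (fun y => ∑ i, f i y) xstar :=
    Filter.Eventually.of_forall fun y => le_of_mul_le_mul_left (hx y) hn'
  have h1 := hmin.fderiv_eq_zero
  rw [fderiv_fun_sum fun i _ => (hf i).differentiable (by norm_num) xstar] at h1
  apply (InnerProductSpace.toDual ℝ (Vec d)).injective
  rw [map_sum, map_zero, ← h1]
  exact Finset.sum_congr rfl fun i _ => toDual_gradient

/-- One step of SIQN: the new error is bounded by the approximation errors of the Hessians and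
the errors of the stored points. -/
lemma norm_step_sub_le (hn : 0 < n) (hd : 0 < d) (hμ : 0 < μ) (hL : 0 < L)
    (hf : ∀ i, ContDiff ℝ 2 (f i)) (hconv : ∀ i, StronglyConvexSmooth μ L (f i))
    (hLip : ∀ i, HessianLipschitz Lt (f i)) {xstar : Vec d}
    (hgrad : ∑ i, gradient (f i) xstar = 0) {z : Fin n → Vec d} {B : Fin n → Mat d} {s e : ℝ}
    (hB : ∀ i, (B i).IsSymm)
    (hHB : ∀ i v, quadForm (hessian (f i) (z i)) v ≤ quadForm (B i) v)
    (hs0 : 0 ≤ s) (hs : ∀ i, sigmaErr (B i) (hessian (f i) (z i)) ≤ s)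
    (he : ∀ i, ‖z i - xstar‖ ≤ e) :
    ‖(WithLp.toLp 2 ((∑ i, B i)⁻¹ *ᵥ
        (∑ i, (B i *ᵥ (z i).ofLp - (gradient (f i) (z i)).ofLp))) : Vec d) - xstar‖ ≤
      (L * s + Lt * e) / μ * e := by
  have hn' : (0 : ℝ) < n := by exact_mod_cast hn
  have hLt : 0 ≤ Lt := (hLip ⟨0, hn⟩).nonneg hd
  have he0 : 0 ≤ e := (norm_nonneg _).trans (he ⟨0, hn⟩)
  set S := ∑ i, B i with hS
  have hSs : S.IsSymm := by
    rw [hS, IsSymm, transpose_sum]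
    exact Finset.sum_congr rfl fun i _ => (hB i).eq
  have hSm : ∀ v, (n * μ) * (v ⬝ᵥ v) ≤ quadForm S v := fun v => by
    rw [hS, quadForm_sum]
    calc (n * μ) * (v ⬝ᵥ v) = ∑ _i : Fin n, μ * (v ⬝ᵥ v) := by simp [mul_assoc]
      _ ≤ _ := Finset.sum_le_sum fun i _ =>
        (quadForm_hessian_bounds (hf i) (hconv i) (z i) v).1.trans (hHB i v)
  have hSd : S.PosDef := posDef_of_mul_dotProduct_le (by positivity) hSs hSm
  -- The gradients at `xstar` may be subtracted because they sum to zero; the new error is then S⁻¹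
  -- ∑ wᵢ.
  set w : Fin n → Vec d := fun i => WithLp.toLp 2 (B i *ᵥ (z i - xstar).ofLp)
    - (gradient (f i) (z i) - gradient (f i) xstar) with hw
  have hwle : ∀ i, ‖w i‖ ≤ (L * s + Lt * e) * e := by
    intro i
    have hHd := hessian_posDef hμ (hf i) (hconv i) (z i)
    have hBH : (B i - hessian (f i) (z i)).PosSemidef :=
      posSemidef_of_nonneg ((hB i).sub hHd.isSymm) fun v => by
        rw [quadForm_sub]; linarith [hHB i v]
    -- Splits the residual into the Hessian approximation error and the Taylor remainder of the
    -- gradient.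
    have e1 : w i = WithLp.toLp 2 ((B i - hessian (f i) (z i)) *ᵥ (z i - xstar).ofLp)
        + (gradient (f i) xstar - gradient (f i) (z i)
          - fderiv ℝ (gradient (f i)) (z i) (xstar - z i)) := by
      have : fderiv ℝ (gradient (f i)) (z i) (xstar - z i) =
          -WithLp.toLp 2 (hessian (f i) (z i) *ᵥ (z i - xstar).ofLp) := by
        rw [hessian_mulVec, WithLp.toLp_ofLp, ← map_neg, neg_sub]
      simp only [this, hw, sub_mulVec, WithLp.toLp_sub]
      abel
    have e2 := norm_mulVec_le_trace_mul hBH (z i - xstar)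
    have e3 := norm_gradient_sub_sub_le (hf i) hd (hLip i) (z i) xstar
    have e4 := trace_le_sigmaErr (hB i) hHd (hHB i)
      (fun v => (quadForm_hessian_bounds (hf i) (hconv i) (z i) v).2)
    have e5 : (B i - hessian (f i) (z i)).trace ≤ L * s :=
      e4.trans (mul_le_mul_of_nonneg_left (hs i) hL.le)
    rw [norm_sub_rev xstar] at e3
    have e6 : ‖z i - xstar‖ ^ 2 ≤ e * e := by
      rw [pow_two]; exact mul_self_le_mul_self (norm_nonneg _) (he i)
    calc ‖w i‖ ≤ _ := by rw [e1]; exact norm_add_le _ _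
      _ ≤ L * s * e + Lt * (e * e) := add_le_add
          (e2.trans (mul_le_mul e5 (he i) (norm_nonneg _) (by positivity)))
          (e3.trans (mul_le_mul_of_nonneg_left e6 hLt))
      _ = _ := by ring
  have hsum : ∑ i, (B i *ᵥ (z i).ofLp - (gradient (f i) (z i)).ofLp) =
      (∑ i, w i).ofLp + S *ᵥ xstar.ofLp := by
    have hg : ∑ i, (gradient (f i) xstar).ofLp = 0 := by
      rw [← WithLp.ofLp_sum, hgrad, WithLp.ofLp_zero]
    have hterm : ∀ i, B i *ᵥ (z i).ofLp - (gradient (f i) (z i)).ofLp =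
        (w i).ofLp + B i *ᵥ xstar.ofLp - (gradient (f i) xstar).ofLp := fun i => by
      simp only [hw, WithLp.ofLp_sub, mulVec_sub]
      abel
    simp_rw [hterm]
    rw [Finset.sum_sub_distrib, hg, sub_zero, Finset.sum_add_distrib, WithLp.ofLp_sum, hS,
      sum_mulVec]
  have hx : (WithLp.toLp 2 (S⁻¹ *ᵥ
        (∑ i, (B i *ᵥ (z i).ofLp - (gradient (f i) (z i)).ofLp))) : Vec d) - xstar =
      WithLp.toLp 2 (S⁻¹ *ᵥ (∑ i, w i).ofLp) := by
    rw [hsum, mulVec_add, mulVec_mulVec,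
      nonsing_inv_mul _ ((isUnit_iff_isUnit_det S).1 hSd.isUnit), one_mulVec, WithLp.toLp_add]
    simp
  rw [hx]
  have h1 := mul_norm_inv_mulVec_le hSd hSm (∑ i, w i)
  have h2 : ‖∑ i, w i‖ ≤ n * ((L * s + Lt * e) * e) :=
    (norm_sum_le_of_le _ fun i _ => hwle i).trans (by simp)
  have h3 := h1.trans h2
  rw [mul_assoc] at h3
  have h4 := le_of_mul_le_mul_left h3 hn'
  rw [div_mul_eq_mul_div, le_div_iff₀ hμ]
  linarith

end Step

end SIQN

/-! ### Update counts and the comparison sequences. -/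

namespace SIQN

open Matrix

section Epochs

/-- The number of times the index `i` has been updated after `t` cyclic steps. -/
def updateCount (n t i : ℕ) : ℕ := (t + (n - 1 - i)) / n

lemma updateCount_zero {n i : ℕ} (hi : i < n) : updateCount n 0 i = 0 :=
  Nat.div_eq_of_lt (by omega)

lemma div_le_updateCount (n t i : ℕ) : t / n ≤ updateCount n t i :=
  Nat.div_le_div_right (by omega)

lemma updateCount_active {n t i : ℕ} (hi : i < n) (h : i = t % n) :
    updateCount n t i = t / n ∧ updateCount n (t + 1) i = t / n + 1 := by
  have ht := Nat.div_add_mod t n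
  rw [← h] at ht
  have hn : 0 < n := by omega
  constructor
  · rw [updateCount, show t + (n - 1 - i) = n * (t / n) + (n - 1) by omega,
      Nat.mul_add_div hn, Nat.div_eq_of_lt (show n - 1 < n by omega), add_zero]
  · rw [updateCount, show t + 1 + (n - 1 - i) = n * (t / n + 1) by rw [mul_add]; omega,
      Nat.mul_div_cancel_left _ hn]

lemma updateCount_other {n t i : ℕ} (hi : i < n) (h : i ≠ t % n) :
    updateCount n (t + 1) i = updateCount n t i := by
  have hn : 0 < n := by omega
  rw [updateCount, updateCount, show t + 1 + (n - 1 - i) = t + (n - 1 - i) + 1 by omega,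
    Nat.succ_div, if_neg, add_zero]
  intro hdvd
  obtain ⟨q, hq⟩ := hdvd
  apply h
  have ht : t + n = n * q + i := by omega
  rw [← Nat.add_mod_right, ht, Nat.mul_add_mod, Nat.mod_eq_of_lt hi]

end Epochs

section Rate

variable {r ε σ₀ b : ℝ}

/-- The bound for the stored points that have been updated `k` times. -/
noncomputable def errBound (r ε : ℝ) (k : ℕ) : ℝ := ε * r ^ ((k + 1) * k / 2)

/-- The bound for the Hessian approximations that have been updated `k` times. -/
noncomputable def sigmaBound (r σ₀ b : ℝ) (k : ℕ) : ℝ := r ^ k * (σ₀ + b * (1 - r ^ k))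

lemma errBound_succ (k : ℕ) : errBound r ε (k + 1) = r ^ (k + 1) * errBound r ε k := by
  rw [errBound, errBound, show (k + 1 + 1) * (k + 1) / 2 = (k + 1) * k / 2 + (k + 1) by
    rw [show (k + 1 + 1) * (k + 1) = (k + 1) * k + (k + 1) * 2 by ring,
      Nat.add_mul_div_right _ _ two_pos], pow_add]
  ring

lemma errBound_nonneg (hr : 0 ≤ r) (hε : 0 ≤ ε) (k : ℕ) : 0 ≤ errBound r ε k := by
  unfold errBound; positivity

lemma errBound_antitone (hr : 0 ≤ r) (hr1 : r ≤ 1) (hε : 0 ≤ ε) : Antitone (errBound r ε) :=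
  antitone_nat_of_succ_le fun k => by
    rw [errBound_succ]
    exact mul_le_of_le_one_left (errBound_nonneg hr hε k) (pow_le_one₀ hr hr1)

lemma errBound_le_pow (hr : 0 ≤ r) (hr1 : r ≤ 1) (hε : 0 ≤ ε) (k : ℕ) :
    errBound r ε k ≤ ε * r ^ k := by
  induction k with
  | zero => simp [errBound]
  | succ k ih =>
    rw [errBound_succ]
    have h1 := errBound_antitone hr hr1 hε (Nat.zero_le k)
    have h2 : errBound r ε 0 = ε := by simp [errBound]
    rw [h2] at h1
    rw [mul_comm ε]
    exact mul_le_mul_of_nonneg_left h1 (by positivity)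

/-- Amounts to k(k+1)/2 + 1 ≥ 2k. The extra factor r is needed, for instance at k = 1. -/
lemma mul_errBound_le (hr : 0 ≤ r) (hr1 : r ≤ 1) (hε : 0 ≤ ε) (k : ℕ) :
    r * errBound r ε k ≤ ε * r ^ (2 * k) := by
  match k with
  | 0 => simpa [errBound] using mul_le_of_le_one_left hε hr1
  | k + 1 =>
    rw [errBound_succ, show 2 * (k + 1) = (k + 1) + 1 + k by ring, pow_add _ (k + 1 + 1),
      pow_succ _ (k + 1)]
    have := mul_le_mul_of_nonneg_left (errBound_le_pow hr hr1 hε k)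
      (by positivity : 0 ≤ r ^ (k + 1) * r)
    linarith

lemma sigmaBound_nonneg (hr : 0 ≤ r) (hr1 : r ≤ 1) (hσ : 0 ≤ σ₀) (hb : 0 ≤ b) (k : ℕ) :
    0 ≤ sigmaBound r σ₀ b k := by
  have : 0 ≤ 1 - r ^ k := sub_nonneg.2 (pow_le_one₀ hr hr1)
  unfold sigmaBound; positivity

lemma sigmaBound_le (hr : 0 ≤ r) (hr1 : r ≤ 1) (hσ : 0 ≤ σ₀) (hb : 0 ≤ b) {j k : ℕ}
    (hjk : j ≤ k) : sigmaBound r σ₀ b k ≤ r ^ j * (σ₀ + b) := by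
  have h1 : r ^ k ≤ r ^ j := pow_le_pow_of_le_one hr hr1 hjk
  have h2 : 0 ≤ 1 - r ^ k := sub_nonneg.2 (pow_le_one₀ hr hr1)
  have h3 : 0 ≤ b * r ^ k := by positivity
  exact mul_le_mul h1 (by linarith) (by positivity) (by positivity)

/-- The value b = Dε/(r(1 - r)) makes `sigmaBound` solve the recursion s ↦ r s + Dε r^(2k) exactly.
-/
lemma le_sigmaBound_succ {D : ℝ} (hr : 0 < r) (hr1 : r < 1) (hε : 0 ≤ ε) (hD : 0 ≤ D) (k : ℕ) :
    r * (sigmaBound r σ₀ (D * ε / (r * (1 - r))) k + D * errBound r ε k) ≤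
      sigmaBound r σ₀ (D * ε / (r * (1 - r))) (k + 1) := by
  have h1 : (1 - r) ≠ 0 := by linarith
  have h2 := mul_le_mul_of_nonneg_left (mul_errBound_le hr.le hr1.le hε k) hD
  have h3 : sigmaBound r σ₀ (D * ε / (r * (1 - r))) (k + 1) =
      r * sigmaBound r σ₀ (D * ε / (r * (1 - r))) k + D * (ε * r ^ (2 * k)) := by
    simp only [sigmaBound, pow_succ, pow_mul']
    field_simp
    ring
  rw [h3]
  linarith

end Rate

/-! ### Induction along a run and choice of constants. -/

/-- For β ≤ 1 all higher powers are at most β, and 4 + 6 + 4 + 1 = 15. -/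
lemma one_add_pow_four_le {β g : ℝ} (hβ : 0 ≤ β) (hg : β ≤ g) (hg1 : g ≤ 1) :
    (1 + β) ^ 4 ≤ 1 + 15 * g := by
  have h1 : β ^ 2 ≤ β := by nlinarith
  have h2 : β ^ 3 ≤ β := by nlinarith [mul_nonneg hβ (sub_nonneg.2 h1)]
  have h3 : β ^ 4 ≤ β := by nlinarith [mul_nonneg hβ (sub_nonneg.2 h2)]
  nlinarith

/-- Along a run of SIQN that starts close enough, the stored points and the Hessian
approximations that have been updated `k` times satisfy the `k`-th bounds. -/
lemma IsRun.bounds {n d : ℕ} (hn : 0 < n) (hd : 0 < d) {μ L Lt : ℝ} (hμ : 0 < μ) (hL : 0 < L)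
    {f : Fin n → Vec d → ℝ} (hf : ∀ i, ContDiff ℝ 2 (f i))
    (hconv : ∀ i, StronglyConvexSmooth μ L (f i)) (hLip : ∀ i, HessianLipschitz Lt (f i))
    {xstar : Vec d} (hgrad : ∑ i, gradient (f i) xstar = 0) {r G D ε σ₀ b : ℝ}
    (hr_eq : r = 1 - μ / (d * L)) (hr : 0 < r) (hr1 : r < 1)
    (hG : G = Lt * μ ^ (-(3 / 2) : ℝ) * √L) (hD : D = 15 * G * (1 + d))
    (hb : b = D * ε / (r * (1 - r))) (hε : 0 < ε) (hσ : 0 < σ₀) (hGε : G * ε ≤ 1)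
    (hτ : σ₀ + b ≤ 1) (hrate : (L * (σ₀ + b) + Lt * ε) / μ ≤ r)
    {x : ℕ → Vec d} {z : ℕ → Fin n → Vec d} {B : ℕ → Fin n → Mat d}
    (hrun : IsRun (Lt * μ ^ (-(3 / 2) : ℝ)) f x z B) (hx0 : ‖x 0 - xstar‖ ≤ ε)
    (hσ0 : ∀ i, sigmaErr (B 0 i) (hessian (f i) (x 0)) ≤ σ₀) (t : ℕ) :
    (∀ i, (B t i).IsSymm ∧ (∀ v, quadForm (hessian (f i) (z t i)) v ≤ quadForm (B t i) v) ∧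
      sigmaErr (B t i) (hessian (f i) (z t i)) ≤ sigmaBound r σ₀ b (updateCount n t i) ∧
      ‖z t i - xstar‖ ≤ errBound r ε (updateCount n t i)) ∧
    ‖x (t + 1) - xstar‖ ≤ errBound r ε (t / n + 1) := by
  have hLt : 0 ≤ Lt := (hLip ⟨0, hn⟩).nonneg hd
  have hG0 : 0 ≤ G := by rw [hG]; positivity
  have hD0 : 0 ≤ D := by rw [hD]; positivity
  have hb0 : 0 ≤ b := by
    rw [hb]; have : 0 < 1 - r := by linarith
    positivity
  have hstep : ∀ t, (∀ i, (B t i).IsSymm ∧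
      (∀ v, quadForm (hessian (f i) (z t i)) v ≤ quadForm (B t i) v) ∧
      sigmaErr (B t i) (hessian (f i) (z t i)) ≤ sigmaBound r σ₀ b (updateCount n t i) ∧
      ‖z t i - xstar‖ ≤ errBound r ε (updateCount n t i)) →
      ‖x (t + 1) - xstar‖ ≤ errBound r ε (t / n + 1) := by
    intro t ih
    -- Every component has been updated at least t / n times, so the bounds at index t / n hold
    -- uniformly.
    rw [hrun.x_step t]
    refine (norm_step_sub_le hn hd hμ hL hf hconv hLip hgrad (fun i => (ih i).1)
      (fun i => (ih i).2.1) (s := r ^ (t / n) * (σ₀ + b)) (e := errBound r ε (t / n))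
      (by positivity)
      (fun i => (ih i).2.2.1.trans (sigmaBound_le hr.le hr1.le hσ.le hb0
        (div_le_updateCount n t i)))
      (fun i => (ih i).2.2.2.trans (errBound_antitone hr.le hr1.le hε.le
        (div_le_updateCount n t i)))).trans ?_
    rw [errBound_succ]
    refine mul_le_mul_of_nonneg_right ?_ (errBound_nonneg hr.le hε.le _)
    have h1 := mul_le_mul_of_nonneg_left (errBound_le_pow hr.le hr1.le hε.le (t / n)) hLt
    have h2 := mul_le_mul_of_nonneg_left hrate (by positivity : 0 ≤ r ^ (t / n))
    rw [← pow_succ, ← mul_div_assoc, div_le_iff₀ hμ] at h2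
    rw [div_le_iff₀ hμ]
    linarith
  have hmain : ∀ t, ∀ i, (B t i).IsSymm ∧
      (∀ v, quadForm (hessian (f i) (z t i)) v ≤ quadForm (B t i) v) ∧
      sigmaErr (B t i) (hessian (f i) (z t i)) ≤ sigmaBound r σ₀ b (updateCount n t i) ∧
      ‖z t i - xstar‖ ≤ errBound r ε (updateCount n t i) := by
    intro t
    induction t with
    | zero =>
      intro i
      have h0 := hrun.B_init i
      refine ⟨?_, fun v => ?_, ?_, ?_⟩
      · simpa using h0.isSymm.add (hessian_isSymm (hf i) (z 0 i))
      · have := h0.quadForm_nonneg v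
        rw [quadForm_sub] at this
        linarith
      · rw [updateCount_zero i.2, hrun.z_init i]
        simpa [sigmaBound] using hσ0 i
      · rw [updateCount_zero i.2, hrun.z_init i]
        simpa [errBound] using hx0
    | succ t ih =>
      intro i
      by_cases hi : (i : ℕ) = t % n
      · obtain ⟨hc, hc'⟩ := updateCount_active i.2 hi
        have hxt := hstep t ih
        obtain ⟨hBs, hHB, hσt, hzt⟩ := ih i
        rw [hc] at hσt hzt
        have hz : ‖z (t + 1) i - xstar‖ ≤ errBound r ε (t / n + 1) := by
          rw [hrun.z_active t i hi]; exact hxt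
        obtain ⟨hBs', hHB', β, hβ0, hβ, hσ'⟩ := (hrun.B_active t i hi).bounds hμ hL hLt
          (by rw [← hr_eq]; exact hr.le) (hf i) (hconv i) (hLip i) hBs hHB
        rw [hc']
        refine ⟨hBs', hHB', hσ'.trans ?_, hz⟩
        set k := t / n
        set E := errBound r ε k
        set s := sigmaBound r σ₀ b k
        have hE0 : 0 ≤ E := errBound_nonneg hr.le hε.le k
        have hEε : E ≤ ε := (errBound_le_pow hr.le hr1.le hε.le k).trans
          (mul_le_of_le_one_right hε.le (pow_le_one₀ hr.le hr1.le))
        have hs0 : 0 ≤ s := sigmaBound_nonneg hr.le hr1.le hσ.le hb0 k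
        have hs1 : s ≤ 1 := by
          have := sigmaBound_le hr.le hr1.le hσ.le hb0 (Nat.zero_le k)
          rw [pow_zero, one_mul] at this
          exact this.trans hτ
        -- Both endpoints are within E of the minimizer; the 2 cancels the 1/2 in β.
        have hmove : ‖z (t + 1) i - z t i‖ ≤ 2 * E := by
          have h1 := hz.trans (errBound_antitone hr.le hr1.le hε.le (Nat.le_succ k))
          have h2 := norm_sub_le (z (t + 1) i - xstar) (z t i - xstar)
          rw [sub_sub_sub_cancel_right] at h2
          linarith
        have hβG : β ≤ G * E := by
          have h1 : 0 ≤ Lt * μ ^ (-(3 / 2) : ℝ) / 2 * √L := by positivity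
          have h2 := hβ.trans (mul_le_mul_of_nonneg_left hmove h1)
          rw [hG]
          linarith
        have hGE : G * E ≤ 1 := (mul_le_mul_of_nonneg_left hEε hG0).trans hGε
        have hpow := one_add_pow_four_le hβ0 hβG hGE
        have hsd : 0 ≤ s + d := by positivity
        have h1 : (1 + β) ^ 4 * (sigmaErr (B t i) (hessian (f i) (z t i)) + d) ≤
            (1 + 15 * (G * E)) * (s + d) :=
          (mul_le_mul_of_nonneg_left (by linarith) (by positivity)).trans
            (mul_le_mul_of_nonneg_right hpow hsd)
        -- Here s ≤ 1 makes the perturbation linear in E, with the constant D = 15G(1 + d).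
        have h2 : G * E * (s + d) ≤ G * E * (1 + d) :=
          mul_le_mul_of_nonneg_left (by linarith) (by positivity)
        have h3 := le_sigmaBound_succ (σ₀ := σ₀) hr hr1 hε.le hD0 k
        rw [← hb] at h3
        rw [← hr_eq]
        refine le_trans (mul_le_mul_of_nonneg_left ?_ hr.le) h3
        rw [hD]
        linarith
      · rw [hrun.z_other t i hi, hrun.B_other t i hi, updateCount_other i.2 hi]
        exact ih i
  exact ⟨hmain t, hstep t (hmain t)⟩

lemma le_of_stronglyConvexSmooth {d : ℕ} (hd : 0 < d) {μ L : ℝ} {f : Vec d → ℝ}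
    (h : StronglyConvexSmooth μ L f) : μ ≤ L := by
  have h1 := h 0 (EuclideanSpace.single ⟨0, hd⟩ 1)
  have h2 := h1.1.trans h1.2
  simp at h2
  linarith

/-- A positive `ε` that makes finitely many linear quantities small. -/
lemma exists_small_constants {μ L Lt r G D : ℝ} (hμ : 0 < μ) (hL : 0 < L) (hLt : 0 ≤ Lt)
    (hr : 0 < r) (hr1 : r < 1) (hG : 0 ≤ G) (hD : 0 ≤ D) :
    ∃ ε σ₀ : ℝ, 0 < ε ∧ 0 < σ₀ ∧ G * ε ≤ 1 ∧ σ₀ + D * ε / (r * (1 - r)) ≤ 1 ∧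
      (L * (σ₀ + D * ε / (r * (1 - r))) + Lt * ε) / μ ≤ r := by
  have h1r : 0 < 1 - r := by linarith
  set D' := D / (r * (1 - r)) with hD'
  have hD'0 : 0 ≤ D' := by positivity
  -- Half of each budget, 1 and rμ, goes to the terms in ε; σ₀ takes the other half.
  set c := min (1 / 2) (r * μ / 2)
  have hc : 0 < c := by positivity
  have hc1 : c ≤ 1 / 2 := min_le_left _ _
  have hc2 : c ≤ r * μ / 2 := min_le_right _ _
  set A := G + D' + L * D' + Lt with hA
  have hLD : 0 ≤ L * D' := by positivity
  have hA0 : 0 ≤ A := by positivity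
  set ε := c / (A + 1)
  have hε : 0 < ε := by positivity
  have hAε : A * ε ≤ c := by
    rw [mul_div_assoc', div_le_iff₀ (by positivity)]
    nlinarith
  have e1 : 0 ≤ G * ε := by positivity
  have e2 : 0 ≤ D' * ε := by positivity
  have e3 : 0 ≤ L * D' * ε := by positivity
  have e4 : 0 ≤ Lt * ε := by positivity
  have hexp : A * ε = G * ε + D' * ε + L * D' * ε + Lt * ε := by rw [hA]; ring
  have hDe : D * ε / (r * (1 - r)) = D' * ε := by rw [hD']; ring
  have hσ : L * min (1 / 2) (r * μ / (2 * L)) ≤ r * μ / 2 := by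
    refine (mul_le_mul_of_nonneg_left (min_le_right _ _) hL.le).trans (le_of_eq ?_)
    field_simp
  have hσ1 : min (1 / 2) (r * μ / (2 * L)) ≤ 1 / 2 := min_le_left _ _
  refine ⟨ε, min (1 / 2) (r * μ / (2 * L)), hε, by positivity, by linarith, ?_, ?_⟩
  · rw [hDe]; linarith
  · rw [hDe, div_le_iff₀ hμ]; linarith

end SIQN

theorem mainTheorem6 (n d : ℕ) (hn : 0 < n) (hd : 0 < d) (μ L Lt : ℝ) (hμ : 0 < μ)
    (f : Fin n → SIQN.Vec d → ℝ)
    (hf : ∀ i, ContDiff ℝ 2 (f i))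
    (hconv : ∀ i, SIQN.StronglyConvexSmooth μ L (f i))
    (hLip : ∀ i, SIQN.HessianLipschitz Lt (f i))
    (xstar : SIQN.Vec d)
    (hxstar : ∀ y, (1 / (n : ℝ)) * ∑ i, f i xstar ≤ (1 / (n : ℝ)) * ∑ i, f i y)
    (ρ : ℝ) (hρ_pos : 0 < ρ) (hρ_lt : ρ < 1 - μ / (d * L)) :
    ∃ ε σ₀ : ℝ, 0 < ε ∧ 0 < σ₀ ∧
      ∀ (x : ℕ → SIQN.Vec d) (z : ℕ → Fin n → SIQN.Vec d) (B : ℕ → Fin n → SIQN.Mat d),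
        SIQN.IsRun (Lt * μ ^ (-(3 / 2) : ℝ)) f x z B →
        ‖x 0 - xstar‖ ≤ ε →
        (∀ i, SIQN.sigmaErr (B 0 i) (SIQN.hessian (f i) (x 0)) ≤ σ₀) →
        ∃ ζ : ℕ → ℝ,
          (∀ t : ℕ, 1 ≤ t → ‖x t - xstar‖ ≤ ζ ((t - 1) / n)) ∧
          ∀ k : ℕ, ζ k ≤ ε * (1 - μ / (d * L)) ^ ((k + 2) * (k + 1) / 2) := by
  have hL : 0 < L :=
    hμ.trans_le (SIQN.le_of_stronglyConvexSmooth hd (hconv ⟨0, hn⟩))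
  have hLt : 0 ≤ Lt := (hLip ⟨0, hn⟩).nonneg hd
  have hd' : (0 : ℝ) < d := by exact_mod_cast hd
  set r := 1 - μ / (d * L) with hr_eq
  -- The existence of ρ serves to exclude r = 0; positivity permits the division by r in b.
  have hr : 0 < r := hρ_pos.trans hρ_lt
  have hr1 : r < 1 := by
    have : 0 < μ / (d * L) := by positivity
    linarith
  have hgrad := SIQN.sum_gradient_eq_zero hn hf hxstar
  have hG : 0 ≤ Lt * μ ^ (-(3 / 2) : ℝ) * √L := by positivity
  obtain ⟨ε, σ₀, hε, hσ, hGε, hτ, hrate⟩ := SIQN.exists_small_constants hμ hL hLt hr hr1 hG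
    (by positivity : 0 ≤ 15 * (Lt * μ ^ (-(3 / 2) : ℝ) * √L) * (1 + (d : ℝ)))
  -- The index is shifted by one because points computed in the first epoch already have one update.
  refine ⟨ε, σ₀, hε, hσ, fun x z B hrun hx0 hσ0 =>
    ⟨fun k => SIQN.errBound r ε (k + 1), fun t ht => ?_, fun k => le_rfl⟩⟩
  obtain ⟨t, rfl⟩ := Nat.exists_eq_add_of_le' ht
  exact (hrun.bounds hn hd hμ hL hf hconv hLip hgrad hr_eq hr hr1 rfl rfl rfl hε hσ hGε hτ hrate
    hx0 hσ0 t).2
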